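/- Let $d\ge 1$ and $\alpha>0$, let $|n|=(\sum_i n_i^2)^{1/2}$ and $b_n=1+|n|^\alpha$ for $n\in\mathbb{Z}^d$, and let $(q_n)_{n\in\mathbb{Z}^d}$ be independent random variables, each uniformly distributed on $[0,1]$. Consider the random Schrödinger operator $H^\omega=H_0+\sum_{n\in\mathbb{Z}^d}b_n\,q_n(\omega)\,|\delta_n\rangle\langle\delta_n|$ on $\ell^2(\mathbb{Z}^d)$, where $(H_0\varphi)(n)=\sum_{m:\ \sum_i|n_i-m_i|=1}(\varphi(n)-\varphi(m))$ and $(\delta_n)_{n\in\mathbb{Z}^d}$ is the standard basis. For a finite set $\Lambda\subset\mathbb{Z}^d$ let $H^\omega_\Lambda$ be the Hermitian matrix $(\langle\delta_n,H^\omega\delta_m\rangle)_{n,m\in\Lambda}$, and let $E_{H^\omega_\Lambda}(I)$ be its spectral projection onto $I\subset\mathbb{R}$. Then for every finite $\Lambda\subset\mathbb{Z}^d$ and every bounded interval $I\subset\mathbb{R}$ of length $|I|$, the random variables below are integrable and $$\mathbb{E}\big(\operatorname{Tr}E_{H^\omega_\Lambda}(I)\big)\le\sum_{n\in\Lambda}b_n^{-1}|I|,$$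 $$\mathbb{E}\Big(\operatorname{Tr}E_{H^\omega_\Lambda}(I)\,\big(\operatorname{Tr}E_{H^\omega_\Lambda}(I)-1\big)\Big)\le\Big(\sum_{n\in\Lambda}b_n^{-1}|I|\Big)^2.$$ -/

import Mathlib

open MeasureTheory ProbabilityTheory

noncomputable section

/-- The Euclidean length `|n| = (∑ nᵢ²)^{1/2}` of a lattice point `n ∈ ℤ^d`. -/
def latticeNorm {d : ℕ} (n : Fin d → ℤ) : ℝ :=
  Real.sqrt (∑ i, (n i : ℝ) ^ 2)

/-- The coefficient `b_n = 1 + |n|^α`. -/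
def growthCoeff {d : ℕ} (α : ℝ) (n : Fin d → ℤ) : ℝ :=
  1 + latticeNorm n ^ α

/-- The nearest neighbours of `n`: the points `m` with `|n - m|₊ = ∑ |nᵢ - mᵢ| = 1`.
The box `[n - 1, n + 1]` only serves to make this a `Finset`, see `mem_latticeNeighbors`. -/
def latticeNeighbors {d : ℕ} (n : Fin d → ℤ) : Finset (Fin d → ℤ) :=
  (Finset.Icc (n - 1) (n + 1)).filter (fun m => ∑ i, |n i - m i| = 1)

theorem mem_latticeNeighbors {d : ℕ} {n m : Fin d → ℤ} :
    m ∈ latticeNeighbors n ↔ ∑ i, |n i - m i| = 1 := by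
  unfold latticeNeighbors
  rw [Finset.mem_filter, Finset.mem_Icc]
  refine ⟨fun h => h.2, fun h => ⟨?_, h⟩⟩
  have key : ∀ i, |n i - m i| ≤ 1 := fun i => by
    rw [← h]
    exact Finset.single_le_sum (f := fun i => |n i - m i|)
      (fun j _ => abs_nonneg _) (Finset.mem_univ i)
  constructor <;> intro i <;> have := abs_le.1 (key i) <;> simp <;> omega

/-- The free operator `(H₀ φ)(n) = ∑_{|n-m|₊ = 1} (φ(n) - φ(m))`. -/
def freeHamiltonian {d : ℕ} (φ : (Fin d → ℤ) → ℂ) (n : Fin d → ℤ) : ℂ :=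
  ∑ m ∈ latticeNeighbors n, (φ n - φ m)

/-- The operator `H = H₀ + ∑_n b_n q_n |δ_n⟩⟨δ_n|` for a realization `q` of the random field,
acting on functions on `ℤ^d`. -/
def hamiltonian {d : ℕ} (α : ℝ) (q : (Fin d → ℤ) → ℝ) (φ : (Fin d → ℤ) → ℂ)
    (n : Fin d → ℤ) : ℂ :=
  freeHamiltonian φ n + ((growthCoeff α n * q n : ℝ) : ℂ) * φ n

/-- The finite-volume matrix `H_Λ = (⟨δ_n, H δ_m⟩)_{n,m ∈ Λ}`. Here `δ_m = Pi.single m 1`, and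
`⟨δ_n, H δ_m⟩` is the value of `H δ_m` at `n`. -/
def hamiltonianMatrix {d : ℕ} (α : ℝ) (q : (Fin d → ℤ) → ℝ) (Λ : Finset (Fin d → ℤ)) :
    Matrix Λ Λ ℂ :=
  Matrix.of fun n m => hamiltonian α q (Pi.single (m : Fin d → ℤ) 1) n

/-- `H_Λ` is Hermitian, so the functional calculus of `H_Λ` is available. -/
theorem hamiltonianMatrix_isHermitian {d : ℕ} (α : ℝ) (q : (Fin d → ℤ) → ℝ)
    (Λ : Finset (Fin d → ℤ)) : (hamiltonianMatrix α q Λ).IsHermitian := by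
  refine Matrix.IsHermitian.ext fun n m => ?_
  rcases eq_or_ne n m with rfl | hnm
  · simp only [hamiltonianMatrix, hamiltonian, freeHamiltonian, Matrix.of_apply, Pi.single_apply]
    simp only [star_add, star_sum, star_mul', star_sub, RCLike.star_def, Complex.conj_ofReal,
      apply_ite (starRingEnd ℂ), map_one, map_zero]
  · have h1 : (n : Fin d → ℤ) ≠ m := fun h => hnm (Subtype.ext h)
    have h2 : (n : Fin d → ℤ) ∈ latticeNeighbors (m : Fin d → ℤ) ↔
        (m : Fin d → ℤ) ∈ latticeNeighbors (n : Fin d → ℤ) := by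
      rw [mem_latticeNeighbors, mem_latticeNeighbors]
      simp only [abs_sub_comm]
    simp only [hamiltonianMatrix, hamiltonian, freeHamiltonian, Matrix.of_apply, Pi.single_apply,
      if_neg h1, if_neg h1.symm, zero_sub, Finset.sum_neg_distrib, Finset.sum_ite_eq', h2,
      mul_zero, add_zero, RCLike.star_def, map_neg, apply_ite (starRingEnd ℂ), map_one, map_zero]

/-- The spectral projection `E_A(I) = 1_I(A)` of a Hermitian matrix `A`, given by the functional
calculus; every function is continuous on the finite spectrum of `A`. -/
def spectralProjection {ι : Type*} [Fintype ι] [DecidableEq ι] (A : Matrix ι ι ℂ) (I : Set ℝ) :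
    Matrix ι ι ℂ :=
  cfc (I.indicator (1 : ℝ → ℝ)) A

/-- `Tr E_{H_Λ}(I)`. The trace of an orthogonal projection is real. -/
def traceSpectralProjection {d : ℕ} (α : ℝ) (q : (Fin d → ℤ) → ℝ) (Λ : Finset (Fin d → ℤ))
    (I : Set ℝ) : ℝ :=
  (spectralProjection (hamiltonianMatrix α q Λ) I).trace.re

end

/-!
Wegner and Minami estimates for the finite-volume random Schrödinger operator, with the sharp
constants that come from the uniform distribution of `q_n`.

Let `N(A)` be the number of eigenvalues of a Hermitian matrix `A` in the interval `I`, so that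
`N(A) = Tr E_A(I) = ∑ n, ⟨δ_n, E_A(I) δ_n⟩`. Two facts about a perturbation
`B = A + s |δ_n⟩⟨δ_n|` of rank one carry the proof.

* `N(B) ≤ N(A) + 1` (`re_trace_spectralProjection_le_add_one`). Otherwise some `w ≠ 0` with
  `w n = 0` would be a combination of eigenvectors of `B` with eigenvalue in a compact interval,
  and orthogonal to those of `A`; but `A w = B w`, and the distance from `A w` to the multiple of
  `w` by the midpoint of the interval would be both at most and more than half its length times
  `‖w‖`.
* Spectral averaging (`lintegral_spectralProjection_le`): the integral over `t ∈ [0, 1]` of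
  `⟨δ_n, E_{A + c t |δ_n⟩⟨δ_n|}(I) δ_n⟩` is at most `|I| / c`. Klein's inequality
  (`Matrix.IsHermitian.sum_eigenvalues_add_le`) makes `c ⟨δ_n, E([a, ∞)) δ_n⟩` a subgradient in `t`
  of the convex function `Tr (A + c t |δ_n⟩⟨δ_n| - a)₊`, and likewise for `(b, ∞)`. So for
  `I = [a, b]` the integral is, up to the factor `1 / c`, the increment over `[0, 1]` of
  `Tr F`, `F(x) = (x - a)₊ - (x - b)₊ = ∫_a^b 1_{x ≥ E} dE`, and by the first fact each `E`
  contributes at most `1` to it.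

The Wegner estimate follows by integrating the diagonal term at `n` over `q_n` first. For the Minami
estimate, `⟨δ_n, E δ_n⟩ (N - 1)` is bounded by `⟨δ_n, E δ_n⟩ N'`, where `N'` belongs to the matrix
in which `q_n` is replaced by an independent copy. Now `q_n` occurs only in the first factor, and
spectral averaging over it followed by the Wegner estimate for `N'` gives the claim.
-/

open scoped Matrix

/-! ### Eigenvalues of Hermitian matrices and rank-one perturbations -/

section Spectral

variable {ι : Type*} [Fintype ι] [DecidableEq ι]

theorem Matrix.re_mul_diagonal_mul_star_apply_self (V : Matrix ι ι ℂ) (c : ι → ℝ) (i : ι) :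
    ((V * Matrix.diagonal (fun j => (c j : ℂ)) * star V) i i).re = ∑ j, c j * ‖V i j‖ ^ 2 := by
  rw [Matrix.mul_apply, Complex.re_sum]
  refine Finset.sum_congr rfl fun j _ => ?_
  rw [Matrix.mul_diagonal, Matrix.star_apply, mul_right_comm, RCLike.star_def, Complex.mul_conj,
    ← Complex.ofReal_mul, Complex.ofReal_re, Complex.normSq_eq_norm_sq, mul_comm]

theorem Matrix.sum_sq_norm_row_of_mul_star_eq_one {V : Matrix ι ι ℂ} (hV : V * star V = 1)
    (i : ι) : ∑ j, ‖V i j‖ ^ 2 = 1 := by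
  have h := Matrix.re_mul_diagonal_mul_star_apply_self V (fun _ => 1) i
  simpa [hV] using h.symm

theorem Matrix.sum_sq_norm_col_of_star_mul_eq_one {V : Matrix ι ι ℂ} (hV : star V * V = 1)
    (j : ι) : ∑ i, ‖V i j‖ ^ 2 = 1 := by
  have h := Matrix.sum_sq_norm_row_of_mul_star_eq_one (V := star V) (by simpa using hV) j
  simpa [Matrix.star_apply] using h

namespace Matrix.IsHermitian

variable {A B : Matrix ι ι ℂ}

theorem cfc_eq_mul_diagonal_mul_star (hA : A.IsHermitian) (f : ℝ → ℝ) :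
    cfc f A = (hA.eigenvectorUnitary : Matrix ι ι ℂ) *
      Matrix.diagonal (fun j => ((f (hA.eigenvalues j) : ℝ) : ℂ)) *
        star (hA.eigenvectorUnitary : Matrix ι ι ℂ) := by
  rw [hA.cfc_eq f, Matrix.IsHermitian.cfc, Unitary.conjStarAlgAut_apply]
  rfl

theorem eq_mul_diagonal_mul_star (hA : A.IsHermitian) :
    A = (hA.eigenvectorUnitary : Matrix ι ι ℂ) *
      Matrix.diagonal (fun j => (hA.eigenvalues j : ℂ)) *
        star (hA.eigenvectorUnitary : Matrix ι ι ℂ) := by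
  conv_lhs => rw [hA.spectral_theorem, Unitary.conjStarAlgAut_apply]
  rfl

theorem re_cfc_apply_self (hA : A.IsHermitian) (f : ℝ → ℝ) (i : ι) :
    (cfc f A i i).re =
      ∑ j, f (hA.eigenvalues j) * ‖(hA.eigenvectorUnitary : Matrix ι ι ℂ) i j‖ ^ 2 := by
  rw [hA.cfc_eq_mul_diagonal_mul_star]
  exact Matrix.re_mul_diagonal_mul_star_apply_self _ (fun j => f (hA.eigenvalues j)) i

theorem re_trace_cfc (hA : A.IsHermitian) (f : ℝ → ℝ) :
    (cfc f A).trace.re = ∑ j, f (hA.eigenvalues j) := by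
  have h : (cfc f A).trace.re = ∑ i, (cfc f A i i).re := by
    simp [Matrix.trace, Complex.re_sum]
  rw [h]
  simp_rw [hA.re_cfc_apply_self]
  rw [Finset.sum_comm]
  refine Finset.sum_congr rfl fun j _ => ?_
  rw [← Finset.mul_sum, Matrix.sum_sq_norm_col_of_star_mul_eq_one
    (Unitary.coe_star_mul_self hA.eigenvectorUnitary), mul_one]

/-- Klein's inequality `Tr g(A) + Tr (f(A) (B - A)) ≤ Tr g(B)` for a perturbation of the diagonal
entry at `n`, where `f` is a global subgradient of the convex function `g`. -/
theorem sum_eigenvalues_add_le (hA : A.IsHermitian) (hB : B.IsHermitian) {n : ι} {s : ℝ}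
    (hAB : B = A + Matrix.diagonal (Pi.single n (s : ℂ))) {f g : ℝ → ℝ}
    (hfg : ∀ x y, g x + f x * (y - x) ≤ g y) :
    ∑ j, g (hA.eigenvalues j) + s * (cfc f A n n).re ≤ ∑ k, g (hB.eigenvalues k) := by
  set U : Matrix ι ι ℂ := (hA.eigenvectorUnitary : Matrix ι ι ℂ) with hU
  set V : Matrix ι ι ℂ := (hB.eigenvectorUnitary : Matrix ι ι ℂ) with hV
  have hU1 : star U * U = 1 := Unitary.coe_star_mul_self hA.eigenvectorUnitary
  have hU2 : U * star U = 1 := Unitary.coe_mul_star_self hA.eigenvectorUnitary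
  have hV1 : star V * V = 1 := Unitary.coe_star_mul_self hB.eigenvectorUnitary
  have hV2 : V * star V = 1 := Unitary.coe_mul_star_self hB.eigenvectorUnitary
  have hAd : A = U * Matrix.diagonal (fun j => (hA.eigenvalues j : ℂ)) * star U :=
    hA.eq_mul_diagonal_mul_star
  have hBd : B = V * Matrix.diagonal (fun j => (hB.eigenvalues j : ℂ)) * star V :=
    hB.eq_mul_diagonal_mul_star
  -- The numbers `‖W j k‖ ^ 2` form a doubly stochastic matrix, and the eigenvalues of `B` averaged
  -- with the weights of row `j` give the quadratic form of `B` at the `j`-th eigenvector of `A`.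
  set W : Matrix ι ι ℂ := star U * V with hW
  have hW1 : star W * W = 1 := by
    rw [hW, star_mul, star_star, mul_assoc, ← mul_assoc U, hU2, one_mul, hV1]
  have hW2 : W * star W = 1 := by
    rw [hW, star_mul, star_star, mul_assoc, ← mul_assoc V, hV2, one_mul, hU1]
  have hrow := Matrix.sum_sq_norm_row_of_mul_star_eq_one hW2
  have hcol := Matrix.sum_sq_norm_col_of_star_mul_eq_one hW1
  have hmean : ∀ j, ∑ k, hB.eigenvalues k * ‖W j k‖ ^ 2
      = hA.eigenvalues j + s * ‖U n j‖ ^ 2 := by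
    intro j
    have e1 : W * Matrix.diagonal (fun j => (hB.eigenvalues j : ℂ)) * star W
        = Matrix.diagonal (fun j => (hA.eigenvalues j : ℂ))
          + star U * Matrix.diagonal (Pi.single n (s : ℂ)) * U := by
      have e2 : W * Matrix.diagonal (fun j => (hB.eigenvalues j : ℂ)) * star W
          = star U * B * U := by
        conv_rhs => rw [hBd]
        rw [hW, star_mul, star_star]
        simp only [mul_assoc]
      have e3 : star U * A * U = Matrix.diagonal (fun j => (hA.eigenvalues j : ℂ)) := by
        conv_lhs => rw [hAd]
        simp only [mul_assoc, hU1, mul_one]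
        rw [← mul_assoc, hU1, one_mul]
      rw [e2, hAB, mul_add, add_mul, e3]
    rw [← Matrix.re_mul_diagonal_mul_star_apply_self, e1]
    have e4 : (Pi.single n (s : ℂ) : ι → ℂ) = fun j => ((Pi.single n s : ι → ℝ) j : ℂ) := by
      funext j
      rcases eq_or_ne j n with rfl | h <;> simp [*]
    have e5 := Matrix.re_mul_diagonal_mul_star_apply_self (star U) (Pi.single n s) j
    rw [star_star, ← e4] at e5
    rw [Matrix.add_apply, Complex.add_re, e5, Matrix.diagonal_apply_eq, Complex.ofReal_re,
      Finset.sum_eq_single n (fun b _ hb => by simp [hb]) (by simp)]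
    simp [Matrix.star_apply]
  have hpt : ∀ j, g (hA.eigenvalues j) + s * (f (hA.eigenvalues j) * ‖U n j‖ ^ 2)
      ≤ ∑ k, g (hB.eigenvalues k) * ‖W j k‖ ^ 2 := by
    intro j
    calc g (hA.eigenvalues j) + s * (f (hA.eigenvalues j) * ‖U n j‖ ^ 2)
        = ∑ k, (g (hA.eigenvalues j) + f (hA.eigenvalues j) *
            (hB.eigenvalues k - hA.eigenvalues j)) * ‖W j k‖ ^ 2 := by
          have : ∀ k, (g (hA.eigenvalues j) + f (hA.eigenvalues j) *
            (hB.eigenvalues k - hA.eigenvalues j)) * ‖W j k‖ ^ 2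
            = (g (hA.eigenvalues j) - f (hA.eigenvalues j) * hA.eigenvalues j) * ‖W j k‖ ^ 2
              + f (hA.eigenvalues j) * (hB.eigenvalues k * ‖W j k‖ ^ 2) := fun k => by ring
          simp_rw [this]
          rw [Finset.sum_add_distrib, ← Finset.mul_sum, ← Finset.mul_sum, hrow, hmean]
          ring
      _ ≤ _ := Finset.sum_le_sum fun k _ =>
          mul_le_mul_of_nonneg_right (hfg _ _) (sq_nonneg _)
  calc ∑ j, g (hA.eigenvalues j) + s * (cfc f A n n).re
      = ∑ j, (g (hA.eigenvalues j) + s * (f (hA.eigenvalues j) * ‖U n j‖ ^ 2)) := by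
        rw [hA.re_cfc_apply_self, Finset.sum_add_distrib, Finset.mul_sum]
    _ ≤ ∑ j, ∑ k, g (hB.eigenvalues k) * ‖W j k‖ ^ 2 := Finset.sum_le_sum fun j _ => hpt j
    _ = ∑ k, g (hB.eigenvalues k) := by
        rw [Finset.sum_comm]
        simp_rw [← Finset.mul_sum, hcol, mul_one]

theorem sum_sq_norm_star_eigenvectorUnitary_mulVec (hA : A.IsHermitian) (w : ι → ℂ) :
    ∑ j, ‖(star (hA.eigenvectorUnitary : Matrix ι ι ℂ) *ᵥ w) j‖ ^ 2 = ∑ i, ‖w i‖ ^ 2 := by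
  have key : ∀ v : ι → ℂ, ((∑ i, ‖v i‖ ^ 2 : ℝ) : ℂ) = star v ⬝ᵥ v := by
    intro v
    simp only [dotProduct, Pi.star_apply, RCLike.star_def, Complex.ofReal_sum]
    refine Finset.sum_congr rfl fun i _ => ?_
    rw [mul_comm, Complex.mul_conj, Complex.normSq_eq_norm_sq]
  apply Complex.ofReal_injective
  rw [key, key, Matrix.star_mulVec, ← Matrix.dotProduct_mulVec, Matrix.mulVec_mulVec,
    ← Matrix.star_eq_conjTranspose, star_star]
  rw [show (hA.eigenvectorUnitary : Matrix ι ι ℂ) * star (hA.eigenvectorUnitary : Matrix ι ι ℂ) = 1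
    from Unitary.coe_mul_star_self _, Matrix.one_mulVec]

theorem star_eigenvectorUnitary_mulVec_mulVec (hA : A.IsHermitian) (w : ι → ℂ) (j : ι) :
    (star (hA.eigenvectorUnitary : Matrix ι ι ℂ) *ᵥ (A *ᵥ w)) j
      = hA.eigenvalues j * (star (hA.eigenvectorUnitary : Matrix ι ι ℂ) *ᵥ w) j := by
  have h : star (hA.eigenvectorUnitary : Matrix ι ι ℂ) * A
      = Matrix.diagonal (fun j => (hA.eigenvalues j : ℂ)) *
        star (hA.eigenvectorUnitary : Matrix ι ι ℂ) := by
    conv_lhs => rw [show star (hA.eigenvectorUnitary : Matrix ι ι ℂ) * A = star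
      (hA.eigenvectorUnitary : Matrix ι ι ℂ) * _ from congrArg _ hA.eq_mul_diagonal_mul_star]
    rw [← mul_assoc, ← mul_assoc, Unitary.coe_star_mul_self, one_mul]
  rw [Matrix.mulVec_mulVec, h, ← Matrix.mulVec_mulVec, Matrix.mulVec_diagonal]

theorem sum_sq_norm_mulVec_sub (hA : A.IsHermitian) (c : ℝ) (w : ι → ℂ) :
    ∑ i, ‖(A *ᵥ w) i - c * w i‖ ^ 2 = ∑ j, (hA.eigenvalues j - c) ^ 2 *
      ‖(star (hA.eigenvectorUnitary : Matrix ι ι ℂ) *ᵥ w) j‖ ^ 2 := by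
  have h := hA.sum_sq_norm_star_eigenvectorUnitary_mulVec (A *ᵥ w - (c : ℂ) • w)
  simp only [Pi.sub_apply, Pi.smul_apply, smul_eq_mul] at h
  rw [← h]
  refine Finset.sum_congr rfl fun j _ => ?_
  rw [Matrix.mulVec_sub, Matrix.mulVec_smul, Pi.sub_apply, Pi.smul_apply, smul_eq_mul,
    star_eigenvectorUnitary_mulVec_mulVec, ← sub_mul, norm_mul, mul_pow, ← Complex.ofReal_sub,
    Complex.norm_real, Real.norm_eq_abs, sq_abs]

open Classical in
/-- A perturbation of one diagonal entry adds at most one eigenvalue to a compact interval. Neither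
a sign of the perturbation nor an ordering of the eigenvalues is needed. -/
theorem card_eigenvalues_mem_Icc_le (hA : A.IsHermitian) (hB : B.IsHermitian) {n : ι} {s : ℂ}
    (hAB : B = A + Matrix.diagonal (Pi.single n s)) (a b : ℝ) :
    (Finset.univ.filter fun j => hB.eigenvalues j ∈ Set.Icc a b).card ≤
      (Finset.univ.filter fun j => hA.eigenvalues j ∈ Set.Icc a b).card + 1 := by
  by_contra! hlt
  -- If the count grew by two or more, the conditions below, which say that `w` lies in the span of
  -- the eigenvectors of `B` for `[a, b]`, is orthogonal to those of `A`, and vanishes at `n`, would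
  -- be fewer than the dimension.
  let p : ι → Prop := fun j => hB.eigenvalues j ∈ Set.Icc a b
  let r : ι → Prop := fun j => hA.eigenvalues j ∈ Set.Icc a b
  let U := star (hA.eigenvectorUnitary : Matrix ι ι ℂ)
  let V := star (hB.eigenvectorUnitary : Matrix ι ι ℂ)
  let Φ : (ι → ℂ) →ₗ[ℂ] ({j // ¬ p j} → ℂ) × ({j // r j} → ℂ) × ℂ :=
    LinearMap.prod (LinearMap.funLeft ℂ ℂ Subtype.val ∘ₗ V.mulVecLin)
      (LinearMap.prod (LinearMap.funLeft ℂ ℂ Subtype.val ∘ₗ U.mulVecLin) (LinearMap.proj n))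
  have hdim : Module.finrank ℂ (({j // ¬ p j} → ℂ) × ({j // r j} → ℂ) × ℂ)
      < Module.finrank ℂ (ι → ℂ) := by
    rw [Module.finrank_prod, Module.finrank_prod, Module.finrank_fintype_fun_eq_card,
      Module.finrank_fintype_fun_eq_card, Module.finrank_fintype_fun_eq_card, Module.finrank_self,
      Fintype.card_subtype_compl, Fintype.card_subtype, Fintype.card_subtype]
    have hp : (Finset.univ.filter p).card ≤ Fintype.card ι := Finset.card_le_univ _
    have hlt' : (Finset.univ.filter r).card + 1 < (Finset.univ.filter p).card := hlt
    have h : Fintype.card ι - (Finset.univ.filter p).card + ((Finset.univ.filter r).card + 1)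
        < Fintype.card ι := by omega
    convert h
  obtain ⟨w, hw, hw0⟩ := Submodule.exists_mem_ne_zero_of_ne_bot
    (LinearMap.ker_ne_bot_of_finrank_lt (f := Φ) hdim)
  have hΦ : Φ w = 0 := hw
  have h1 : ∀ j, ¬ p j → (V *ᵥ w) j = 0 := fun j hj =>
    congrFun (congrArg Prod.fst hΦ) ⟨j, hj⟩
  have h2 : ∀ j, r j → (U *ᵥ w) j = 0 := fun j hj =>
    congrFun (congrArg (fun z => z.2.1) hΦ) ⟨j, hj⟩
  have h3 : w n = 0 := congrArg (fun z => z.2.2) hΦ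
  have hBw : B *ᵥ w = A *ᵥ w := by
    rw [hAB, Matrix.add_mulVec, add_eq_left]
    funext i
    rw [Matrix.mulVec_diagonal]
    rcases eq_or_ne i n with rfl | hi
    · simp [h3]
    · simp [hi]
  have hpos : 0 < ∑ i, ‖w i‖ ^ 2 := by
    obtain ⟨i, hi⟩ := Function.ne_iff.1 hw0
    exact Finset.sum_pos' (fun _ _ => sq_nonneg _)
      ⟨i, Finset.mem_univ _, by have : 0 < ‖w i‖ := norm_pos_iff.2 hi; positivity⟩
  have hsq : ∀ x : ℝ, x ∈ Set.Icc a b ↔ (x - (a + b) / 2) ^ 2 ≤ ((b - a) / 2) ^ 2 ∧ a ≤ b := by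
    intro x
    constructor
    · rintro ⟨h, h'⟩
      exact ⟨by nlinarith [mul_nonneg (sub_nonneg.2 h) (sub_nonneg.2 h')], h.trans h'⟩
    · rintro ⟨h, h'⟩
      have := abs_le.1 (abs_le_of_sq_le_sq h (by linarith))
      constructor <;> linarith [this.1, this.2]
  have hab : a ≤ b := by
    obtain ⟨j, hj⟩ : (Finset.univ.filter p).Nonempty := Finset.card_pos.1 (by
      change (Finset.univ.filter r).card + 1 < (Finset.univ.filter p).card at hlt
      omega)
    exact ((hsq _).1 (Finset.mem_filter.1 hj).2).2
  have hle : ∑ i, ‖(B *ᵥ w) i - ((a + b) / 2 : ℝ) * w i‖ ^ 2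
      ≤ ((b - a) / 2) ^ 2 * ∑ i, ‖w i‖ ^ 2 := by
    rw [hB.sum_sq_norm_mulVec_sub, ← hB.sum_sq_norm_star_eigenvectorUnitary_mulVec w,
      Finset.mul_sum]
    refine Finset.sum_le_sum fun j _ => ?_
    by_cases hj : p j
    · exact mul_le_mul_of_nonneg_right ((hsq _).1 hj).1 (sq_nonneg _)
    · change _ * ‖(V *ᵥ w) j‖ ^ 2 ≤ _ * ‖(V *ᵥ w) j‖ ^ 2
      simp [h1 j hj]
  have hgt : ((b - a) / 2) ^ 2 * ∑ i, ‖w i‖ ^ 2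
      < ∑ i, ‖(A *ᵥ w) i - ((a + b) / 2 : ℝ) * w i‖ ^ 2 := by
    rw [← hA.sum_sq_norm_star_eigenvectorUnitary_mulVec w] at hpos ⊢
    rw [hA.sum_sq_norm_mulVec_sub, Finset.mul_sum]
    have hstrict : ∀ j, ¬ r j → ((b - a) / 2) ^ 2 < (hA.eigenvalues j - (a + b) / 2) ^ 2 :=
      fun j hj => lt_of_not_ge fun h => hj ((hsq _).2 ⟨h, hab⟩)
    obtain ⟨j, -, hj⟩ := Finset.exists_ne_zero_of_sum_ne_zero hpos.ne'
    refine Finset.sum_lt_sum (fun j _ => ?_) ⟨j, Finset.mem_univ _, ?_⟩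
    · by_cases hj : r j
      · change _ * ‖(U *ᵥ w) j‖ ^ 2 ≤ _ * ‖(U *ᵥ w) j‖ ^ 2
        simp [h2 j hj]
      · exact mul_le_mul_of_nonneg_right (hstrict j hj).le (sq_nonneg _)
    · have hr : ¬ r j := fun hr => hj (by
        change ‖(U *ᵥ w) j‖ ^ 2 = 0
        simp [h2 j hr])
      exact mul_lt_mul_of_pos_right (hstrict j hr) (lt_of_le_of_ne (sq_nonneg _) (Ne.symm hj))
  rw [hBw] at hle
  exact absurd hle (not_le.2 hgt)

end Matrix.IsHermitian

end Spectral

/-! ### Functions on the line with a global subgradient -/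

section Subgradient

variable {h G : ℝ → ℝ}

theorem monotone_of_subgradient (hG : ∀ t s, h t + (s - t) * G t ≤ h s) : Monotone G := by
  intro t s hts
  rcases hts.eq_or_lt with rfl | hlt
  · exact le_rfl
  · have h1 := hG t s
    have h2 := hG s t
    exact le_of_mul_le_mul_left (by linarith : (s - t) * G t ≤ (s - t) * G s) (sub_pos.2 hlt)

theorem continuous_of_subgradient (hG : ∀ t s, h t + (s - t) * G t ≤ h s) : Continuous h := by
  have hconv : ConvexOn ℝ Set.univ h := by
    refine ⟨convex_univ, fun x _ y _ p q hp hq hpq => ?_⟩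
    simp only [smul_eq_mul]
    have h1 := mul_le_mul_of_nonneg_left (hG (p * x + q * y) x) hp
    have h2 := mul_le_mul_of_nonneg_left (hG (p * x + q * y) y) hq
    have h3 : p * (h (p * x + q * y) + (x - (p * x + q * y)) * G (p * x + q * y))
        + q * (h (p * x + q * y) + (y - (p * x + q * y)) * G (p * x + q * y))
        = h (p * x + q * y) := by
      obtain rfl : q = 1 - p := by linarith
      ring
    linarith
  exact continuousOn_univ.1 (hconv.continuousOn isOpen_univ)

theorem hasDerivAt_of_subgradient (hG : ∀ t s, h t + (s - t) * G t ≤ h s) {t : ℝ}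
    (ht : ContinuousAt G t) : HasDerivAt h (G t) t := by
  rw [hasDerivAt_iff_isLittleO]
  have ho : (fun s => (s - t) * (G s - G t)) =o[nhds t] fun s => s - t := by
    have h0 : (fun s => G s - G t) =o[nhds t] fun _ => (1 : ℝ) := by
      rw [Asymptotics.isLittleO_one_iff]
      simpa using ht.sub_const (G t)
    simpa using (Asymptotics.isBigO_refl (fun s => s - t) (nhds t)).mul_isLittleO h0
  refine Asymptotics.IsBigO.trans_isLittleO (Asymptotics.IsBigO.of_bound 1 ?_) ho
  filter_upwards with s
  rw [one_mul, smul_eq_mul, Real.norm_eq_abs, Real.norm_eq_abs]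
  have h1 := hG t s
  have h2 := hG s t
  rw [abs_of_nonneg (by linarith)]
  exact le_trans (by linarith) (le_abs_self _)

/-- A subgradient is monotone, so it is continuous, and hence equal to the derivative, off a
countable set. -/
theorem integral_eq_sub_of_subgradient (hG : ∀ t s, h t + (s - t) * G t ≤ h s) {a b : ℝ}
    (hab : a ≤ b) : ∫ t in a..b, G t = h b - h a := by
  have hmono := monotone_of_subgradient hG
  refine integral_eq_of_hasDerivAt_off_countable_of_le h G hab hmono.countable_not_continuousAt
    (continuous_of_subgradient hG).continuousOn (fun t ht => ?_) hmono.intervalIntegrable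
  exact hasDerivAt_of_subgradient hG (not_not.1 ht.2)

end Subgradient

/-! ### Spectral projections and spectral averaging -/

section SpectralProjection

theorem Matrix.IsHermitian.add_diagonal_ofReal {ι : Type*} [DecidableEq ι] {A : Matrix ι ι ℂ}
    (hA : A.IsHermitian) (v : ι → ℝ) :
    (A + Matrix.diagonal (fun i => (v i : ℂ))).IsHermitian :=
  hA.add (Matrix.isHermitian_diagonal_of_self_adjoint _ (by ext i; simp))

theorem Matrix.IsHermitian.add_diagonal_single_ofReal {ι : Type*} [DecidableEq ι]
    {A : Matrix ι ι ℂ} (hA : A.IsHermitian) (n : ι) (r : ℝ) :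
    (A + Matrix.diagonal (Pi.single n (r : ℂ))).IsHermitian := by
  have h : (Pi.single n (r : ℂ) : ι → ℂ) = fun i => ((Pi.single n r : ι → ℝ) i : ℂ) := by
    funext i
    rcases eq_or_ne i n with rfl | h <;> simp [*]
  rw [h]
  exact hA.add_diagonal_ofReal _

theorem re_trace_eq_sum {ι : Type*} [Fintype ι] (A : Matrix ι ι ℂ) :
    A.trace.re = ∑ i, (A i i).re := by
  simp [Matrix.trace, Complex.re_sum]

variable {ι : Type*} [Fintype ι] [DecidableEq ι] {A B : Matrix ι ι ℂ}

open Classical in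
theorem re_trace_spectralProjection (hA : A.IsHermitian) (I : Set ℝ) :
    (spectralProjection A I).trace.re =
      ((Finset.univ.filter fun j => hA.eigenvalues j ∈ I).card : ℝ) := by
  rw [spectralProjection, hA.re_trace_cfc, Finset.card_filter]
  simp [Set.indicator_apply]

theorem re_spectralProjection_mono (hA : A.IsHermitian) {I J : Set ℝ} (hIJ : I ⊆ J) (i : ι) :
    (spectralProjection A I i i).re ≤ (spectralProjection A J i i).re := by
  rw [spectralProjection, spectralProjection, hA.re_cfc_apply_self, hA.re_cfc_apply_self]
  exact Finset.sum_le_sum fun j _ => mul_le_mul_of_nonneg_right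
    (Set.indicator_le_indicator_of_subset hIJ (fun _ => zero_le_one) _) (sq_nonneg _)

theorem re_spectralProjection_nonneg (hA : A.IsHermitian) (I : Set ℝ) (i : ι) :
    0 ≤ (spectralProjection A I i i).re := by
  rw [spectralProjection, hA.re_cfc_apply_self]
  exact Finset.sum_nonneg fun j _ => mul_nonneg
    (Set.indicator_nonneg (fun _ _ => zero_le_one) _) (sq_nonneg _)

theorem re_trace_spectralProjection_nonneg (hA : A.IsHermitian) (I : Set ℝ) :
    0 ≤ (spectralProjection A I).trace.re := by
  classical
  rw [re_trace_spectralProjection hA]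
  positivity

theorem re_trace_spectralProjection_mul_sub_one_nonneg (hA : A.IsHermitian) (I : Set ℝ) :
    0 ≤ (spectralProjection A I).trace.re * ((spectralProjection A I).trace.re - 1) := by
  classical
  rw [re_trace_spectralProjection hA]
  rcases Nat.eq_zero_or_pos (Finset.univ.filter fun j => hA.eigenvalues j ∈ I).card with h | h
  · simp [h]
  · exact mul_nonneg (Nat.cast_nonneg _) (sub_nonneg.2 (by exact_mod_cast h))

/-- The rank-one bound for an arbitrary interval: the eigenvalues of `B` in `I` already lie in a
compact subinterval of `I`. -/
theorem re_trace_spectralProjection_le_add_one (hA : A.IsHermitian) (hB : B.IsHermitian) {n : ι}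
    {s : ℂ} (hAB : B = A + Matrix.diagonal (Pi.single n s)) {I : Set ℝ} (hI : I.OrdConnected) :
    (spectralProjection B I).trace.re ≤ (spectralProjection A I).trace.re + 1 := by
  classical
  rw [re_trace_spectralProjection hA, re_trace_spectralProjection hB]
  norm_cast
  rcases (Finset.univ.filter fun j => hB.eigenvalues j ∈ I).eq_empty_or_nonempty with h | h
  · simp [h]
  obtain ⟨p, hp, hpmin⟩ := Finset.exists_min_image _ hB.eigenvalues h
  obtain ⟨r, hr, hrmax⟩ := Finset.exists_max_image _ hB.eigenvalues h
  have hsub : Set.Icc (hB.eigenvalues p) (hB.eigenvalues r) ⊆ I :=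
    hI.out (Finset.mem_filter.1 hp).2 (Finset.mem_filter.1 hr).2
  calc (Finset.univ.filter fun j => hB.eigenvalues j ∈ I).card
      ≤ (Finset.univ.filter fun j =>
          hB.eigenvalues j ∈ Set.Icc (hB.eigenvalues p) (hB.eigenvalues r)).card :=
        Finset.card_le_card fun j hj =>
          Finset.mem_filter.2 ⟨Finset.mem_univ _, hpmin j hj, hrmax j hj⟩
    _ ≤ (Finset.univ.filter fun j =>
          hA.eigenvalues j ∈ Set.Icc (hB.eigenvalues p) (hB.eigenvalues r)).card + 1 :=
        hA.card_eigenvalues_mem_Icc_le hB hAB _ _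
    _ ≤ _ := Nat.add_le_add_right (Finset.card_le_card fun j hj =>
        Finset.mem_filter.2 ⟨Finset.mem_univ _, hsub (Finset.mem_filter.1 hj).2⟩) 1

theorem integral_indicator_Ici_eq {a b : ℝ} (hab : a ≤ b) (x : ℝ) :
    ∫ E in a..b, (Set.Ici E).indicator (1 : ℝ → ℝ) x = max (x - a) 0 - max (x - b) 0 := by
  have h : (fun E => (Set.Ici E).indicator (1 : ℝ → ℝ) x) = (Set.Iic x).indicator 1 := by
    funext E
    simp [Set.indicator_apply]
  rw [h, intervalIntegral.integral_of_le hab, integral_indicator_one measurableSet_Iic,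
    measureReal_restrict_apply measurableSet_Iic, Set.inter_comm, Set.Ioc_inter_Iic,
    Real.volume_real_Ioc]
  rcases le_total b x with h1 | h1 <;> rcases le_total a x with h2 | h2 <;>
    simp [h1, h2, hab]
  linarith

theorem intervalIntegrable_indicator_Ici (a b x : ℝ) :
    IntervalIntegrable (fun E => (Set.Ici E).indicator (1 : ℝ → ℝ) x) volume a b := by
  refine Antitone.intervalIntegrable fun E F hEF => ?_
  exact Set.indicator_le_indicator_of_subset (Set.Ici_subset_Ici.2 hEF) (fun _ => zero_le_one) _

/-- The trace of `F`, where `F x = (x - a)₊ - (x - b)₊`, grows by at most `b - a` under a rank-one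
perturbation: `Tr F(C)` is the integral over `E ∈ [a, b]` of the number of eigenvalues of `C` that
are at least `E`. -/
theorem re_trace_cfc_sub_le (hA : A.IsHermitian) (hB : B.IsHermitian) {n : ι} {s : ℂ}
    (hAB : B = A + Matrix.diagonal (Pi.single n s)) {a b : ℝ} (hab : a ≤ b) :
    ((cfc (fun x => max (x - a) 0) B).trace.re - (cfc (fun x => max (x - b) 0) B).trace.re)
      - ((cfc (fun x => max (x - a) 0) A).trace.re - (cfc (fun x => max (x - b) 0) A).trace.re)
      ≤ b - a := by
  have key : ∀ {C : Matrix ι ι ℂ} (_ : C.IsHermitian),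
      (cfc (fun x => max (x - a) 0) C).trace.re - (cfc (fun x => max (x - b) 0) C).trace.re
        = ∫ E in a..b, (spectralProjection C (Set.Ici E)).trace.re ∧
      IntervalIntegrable (fun E => (spectralProjection C (Set.Ici E)).trace.re) volume a b := by
    intro C hC
    simp only [spectralProjection, hC.re_trace_cfc]
    rw [← Finset.sum_sub_distrib, intervalIntegral.integral_finsetSum
      fun j _ => intervalIntegrable_indicator_Ici a b _]
    simp only [integral_indicator_Ici_eq hab, true_and]
    have := IntervalIntegrable.sum Finset.univ
      (fun j (_ : j ∈ Finset.univ) => intervalIntegrable_indicator_Ici a b (hC.eigenvalues j))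
    exact this.congr fun E _ => by simp
  rw [(key hA).1, (key hB).1, ← intervalIntegral.integral_sub (key hB).2 (key hA).2]
  calc ∫ E in a..b, ((spectralProjection B (Set.Ici E)).trace.re
          - (spectralProjection A (Set.Ici E)).trace.re)
      ≤ ∫ _ in a..b, (1 : ℝ) := by
        refine intervalIntegral.integral_mono_on hab ((key hB).2.sub (key hA).2)
          intervalIntegrable_const fun E _ => ?_
        linarith [re_trace_spectralProjection_le_add_one hA hB hAB (Set.ordConnected_Ici (a := E))]
    _ = b - a := by simp

/-- Both `1_{[a, ∞)}` and `1_{(a, ∞)}` are subgradients of `(x - a)₊`. -/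
theorem re_trace_cfc_posPart_subgradient (hA : A.IsHermitian) (hB : B.IsHermitian) {n : ι} {s : ℝ}
    (hAB : B = A + Matrix.diagonal (Pi.single n (s : ℂ))) {a : ℝ} {S : Set ℝ}
    (hS : Set.Ioi a ⊆ S) (hS' : S ⊆ Set.Ici a) :
    (cfc (fun x => max (x - a) 0) A).trace.re + s * (spectralProjection A S n n).re ≤
      (cfc (fun x => max (x - a) 0) B).trace.re := by
  classical
  rw [hA.re_trace_cfc, hB.re_trace_cfc, spectralProjection]
  refine hA.sum_eigenvalues_add_le (g := fun x => max (x - a) 0) hB hAB fun x y => ?_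
  simp only [Set.indicator_apply]
  split_ifs with hx
  · have : a ≤ x := hS' hx
    rw [max_eq_left (by linarith), Pi.one_apply, one_mul]
    exact le_trans (by linarith) (le_max_left _ _)
  · have : x ≤ a := not_lt.1 fun h => hx (hS h)
    rw [max_eq_right (by linarith), zero_mul, add_zero]
    exact le_max_right _ _

/-- Spectral averaging for a compact interval. -/
theorem lintegral_spectralProjection_Icc_le (hA : A.IsHermitian) {c : ℝ} (hc : 0 < c) (n : ι)
    {a b : ℝ} (hab : a ≤ b) :
    ∫⁻ t in Set.Icc (0 : ℝ) 1, ENNReal.ofReal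
      (spectralProjection (A + Matrix.diagonal (Pi.single n ((c * t : ℝ) : ℂ)))
        (Set.Icc a b) n n).re ≤ ENNReal.ofReal (c⁻¹ * (b - a)) := by
  set M : ℝ → Matrix ι ι ℂ := fun t => A + Matrix.diagonal (Pi.single n ((c * t : ℝ) : ℂ)) with hM
  have hMh : ∀ t, (M t).IsHermitian := fun t => hA.add_diagonal_single_ofReal n _
  have hMM : ∀ t s, M s = M t + Matrix.diagonal (Pi.single n ((c * (s - t) : ℝ) : ℂ)) := by
    intro t s
    simp only [hM]
    have h : ((c * s : ℝ) : ℂ) = ((c * t : ℝ) : ℂ) + ((c * (s - t) : ℝ) : ℂ) := by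
      rw [← Complex.ofReal_add]
      ring_nf
    rw [add_assoc, h, Pi.single_add]
    exact congrArg (A + ·) (Matrix.diagonal_add _ _).symm
  have hsub : ∀ (e : ℝ) (S : Set ℝ), Set.Ioi e ⊆ S → S ⊆ Set.Ici e → ∀ t s,
      (cfc (fun x => max (x - e) 0) (M t)).trace.re
        + (s - t) * (c * (spectralProjection (M t) S n n).re)
        ≤ (cfc (fun x => max (x - e) 0) (M s)).trace.re := by
    intro e S h1 h2 t s
    have := re_trace_cfc_posPart_subgradient (hMh t) (hMh s) (hMM t s) h1 h2
    linarith
  have hga := hsub a (Set.Ici a) Set.Ioi_subset_Ici_self subset_rfl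
  have hgb := hsub b (Set.Ioi b) subset_rfl Set.Ioi_subset_Ici_self
  have hdiff : ∀ t, (spectralProjection (M t) (Set.Icc a b) n n).re =
      c⁻¹ * (c * (spectralProjection (M t) (Set.Ici a) n n).re
        - c * (spectralProjection (M t) (Set.Ioi b) n n).re) := by
    intro t
    rw [← mul_sub, inv_mul_cancel_left₀ hc.ne']
    simp only [spectralProjection, (hMh t).re_cfc_apply_self]
    rw [← Finset.sum_sub_distrib]
    refine Finset.sum_congr rfl fun j _ => ?_
    rw [← sub_mul]
    congr 1
    generalize (hMh t).eigenvalues j = x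
    simp only [Set.indicator_apply, Set.mem_Icc, Set.mem_Ici, Set.mem_Ioi, Pi.one_apply]
    by_cases h1 : a ≤ x <;> by_cases h2 : x ≤ b
    · simp [h1, h2, not_lt.2 h2]
    · simp [h1, h2, not_le.1 h2]
    · simp [h1, not_lt.2 h2]
    · exact absurd (hab.trans (not_le.1 h2).le) h1
  have hia := (monotone_of_subgradient hga).intervalIntegrable (μ := volume) (a := 0) (b := 1)
  have hib := (monotone_of_subgradient hgb).intervalIntegrable (μ := volume) (a := 0) (b := 1)
  have hint : IntervalIntegrable (fun t => (spectralProjection (M t) (Set.Icc a b) n n).re)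
      volume 0 1 := by
    simp only [hdiff]
    exact (hia.sub hib).const_mul _
  have hle : ∫ t in (0 : ℝ)..1, (spectralProjection (M t) (Set.Icc a b) n n).re
      ≤ c⁻¹ * (b - a) := by
    simp only [hdiff]
    rw [intervalIntegral.integral_const_mul, intervalIntegral.integral_sub hia hib,
      integral_eq_sub_of_subgradient hga zero_le_one, integral_eq_sub_of_subgradient hgb zero_le_one]
    refine mul_le_mul_of_nonneg_left ?_ (inv_nonneg.2 hc.le)
    have := re_trace_cfc_sub_le (hMh 0) (hMh 1) (hMM 0 1) hab
    linarith
  rw [intervalIntegrable_iff_integrableOn_Icc_of_le zero_le_one] at hint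
  rw [← ofReal_integral_eq_lintegral_ofReal hint
    (Filter.Eventually.of_forall fun t => re_spectralProjection_nonneg (hMh t) _ _)]
  refine ENNReal.ofReal_le_ofReal ?_
  rwa [integral_Icc_eq_integral_Ioc, ← intervalIntegral.integral_of_le zero_le_one]

/-- Spectral averaging for an arbitrary bounded interval. -/
theorem lintegral_spectralProjection_le (hA : A.IsHermitian) {c : ℝ} (hc : 0 < c) (n : ι)
    {I : Set ℝ} (hI : I.OrdConnected) (hI_bdd : Bornology.IsBounded I) :
    ∫⁻ t in Set.Icc (0 : ℝ) 1, ENNReal.ofReal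
      (spectralProjection (A + Matrix.diagonal (Pi.single n ((c * t : ℝ) : ℂ))) I n n).re
        ≤ ENNReal.ofReal (c⁻¹ * volume.real I) := by
  rcases I.eq_empty_or_nonempty with rfl | hne
  · simp [spectralProjection]
  have hab : sInf I ≤ sSup I := csInf_le_csSup hne hI_bdd.bddBelow hI_bdd.bddAbove
  have hsub : I ⊆ Set.Icc (sInf I) (sSup I) :=
    fun x hx => ⟨csInf_le hI_bdd.bddBelow hx, le_csSup hI_bdd.bddAbove hx⟩
  have hvol : sSup I - sInf I ≤ volume.real I := by
    have h := measureReal_mono (μ := volume)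
      (IsConnected.Ioo_csInf_csSup_subset ⟨hne, hI.isPreconnected⟩ hI_bdd.bddBelow hI_bdd.bddAbove)
      hI_bdd.measure_lt_top.ne
    rwa [Real.volume_real_Ioo_of_le hab] at h
  calc _ ≤ _ := lintegral_mono fun t => ENNReal.ofReal_le_ofReal (re_spectralProjection_mono
          (hA.add_diagonal_single_ofReal n _) hsub n)
    _ ≤ _ := lintegral_spectralProjection_Icc_le hA hc n hab
    _ ≤ _ := ENNReal.ofReal_le_ofReal (mul_le_mul_of_nonneg_left hvol (inv_nonneg.2 hc.le))

end SpectralProjection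

/-! ### Measurability of spectral projections -/

section Measurability

variable {ι : Type*} [Fintype ι] [DecidableEq ι] {X : Type*}

open scoped Matrix.Norms.L2Operator in
/-- The L2 operator norm serves only to provide a C⋆-algebra; it induces the usual topology. -/
theorem continuous_cfc_of_isHermitian [TopologicalSpace X] {f : ℝ → ℝ} (hf : Continuous f)
    {M : X → Matrix ι ι ℂ} (hM : Continuous M) (hMh : ∀ x, (M x).IsHermitian) :
    Continuous fun x => cfc f (M x) :=
  Continuous.cfc_of_mem_nhdsSet (p := IsSelfAdjoint) (s := Set.univ) f Filter.univ_mem hM hMh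
    hf.continuousOn

/-- Spectral projections of a continuous family of Hermitian matrices are measurable in the
parameter, although the eigenvectors used to compute them are arbitrary choices. -/
theorem measurable_re_spectralProjection [TopologicalSpace X] [MeasurableSpace X]
    [OpensMeasurableSpace X] {M : X → Matrix ι ι ℂ} (hM : Continuous M)
    (hMh : ∀ x, (M x).IsHermitian) {I : Set ℝ} (hI : MeasurableSet I) (i : ι) :
    Measurable fun x => (spectralProjection (M x) I i i).re := by
  classical
  -- `ν x` is the spectral measure of `M x` at `δ_i`; it suffices to treat half-lines `[a, ∞)`,
  -- whose indicator functions are limits of continuous functions.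
  let ν : X → Measure ℝ := fun x => ∑ j, ENNReal.ofReal
    (‖((hMh x).eigenvectorUnitary : Matrix ι ι ℂ) i j‖ ^ 2) • Measure.dirac ((hMh x).eigenvalues j)
  have hν : ∀ x {S : Set ℝ}, MeasurableSet S →
      ν x S = ENNReal.ofReal (spectralProjection (M x) S i i).re := by
    intro x S hS
    have h0 : ∀ t, 0 ≤ S.indicator (1 : ℝ → ℝ) t := Set.indicator_nonneg fun _ _ => zero_le_one
    rw [spectralProjection, (hMh x).re_cfc_apply_self, ENNReal.ofReal_sum_of_nonneg
      fun j _ => mul_nonneg (h0 _) (sq_nonneg _)]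
    simp only [ν, Measure.coe_finsetSum, Finset.sum_apply, Measure.smul_apply, smul_eq_mul,
      Measure.dirac_apply' _ hS]
    refine Finset.sum_congr rfl fun j _ => ?_
    by_cases hj : (hMh x).eigenvalues j ∈ S <;> simp [hj]
  have hfin : ∀ x, IsFiniteMeasure (ν x) := fun x => ⟨by
    rw [hν x MeasurableSet.univ]; exact ENNReal.ofReal_lt_top⟩
  have hmeas : Measurable ν := by
    refine Measurable.measure_of_isPiSystem
      (BorelSpace.measurable_eq.trans (borel_eq_generateFrom_Ici ℝ)) isPiSystem_Ici ?_ ?_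
    · rintro _ ⟨a, rfl⟩
      simp only [hν _ measurableSet_Ici]
      refine ENNReal.measurable_ofReal.comp ?_
      let f : ℕ → ℝ → ℝ := fun k t => max 0 (1 - k * max (a - t) 0)
      have hf : ∀ k, Continuous (f k) := fun k => by fun_prop
      refine measurable_of_tendsto_metrizable
        (f := fun k x => (cfc (f k) (M x) i i).re) (fun k => ?_) ?_
      · have h := continuous_cfc_of_isHermitian (hf k) hM hMh
        exact (Complex.continuous_re.comp (h.matrix_elem i i)).measurable
      · rw [tendsto_pi_nhds]
        intro x
        simp only [spectralProjection, (hMh x).re_cfc_apply_self]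
        refine tendsto_finsetSum _ fun j _ => Filter.Tendsto.mul_const _ ?_
        generalize (hMh x).eigenvalues j = t
        by_cases ht : a ≤ t
        · simp [f, ht]
        · have hpos : 0 < a - t := sub_pos.2 (not_le.1 ht)
          have hev : ∀ᶠ k : ℕ in Filter.atTop, 0 = f k t := by
            obtain ⟨N, hN⟩ := exists_nat_gt (1 / (a - t))
            filter_upwards [Filter.eventually_ge_atTop N] with k hk
            have h1 : 1 < k * (a - t) := by
              rw [div_lt_iff₀ hpos] at hN
              exact hN.trans_le (mul_le_mul_of_nonneg_right (by exact_mod_cast hk) hpos.le)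
            simp only [f]
            rw [max_eq_left hpos.le, max_eq_left (by linarith)]
          simpa [ht] using tendsto_const_nhds.congr' hev
    · simp only [hν _ MeasurableSet.univ]
      have h : ∀ x, spectralProjection (M x) Set.univ = 1 := fun x => by
        rw [spectralProjection, Set.indicator_univ]
        exact cfc_one ℝ (M x) (hMh x)
      simp [h]
  have h := (Measure.measurable_measure.1 hmeas I hI).ennreal_toReal
  simpa only [hν _ hI, ENNReal.toReal_ofReal (re_spectralProjection_nonneg (hMh _) I i)] using h

end Measurability

/-! ### Wegner and Minami estimates for a random diagonal -/

section RandomDiagonal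

section

variable {ι : Type*} [DecidableEq ι]

/-- The matrix `A + ∑ i, c i * x i |δ_i⟩⟨δ_i|`, as a function of the variables `x`. -/
def diagonalPerturbation (A : Matrix ι ι ℂ) (c x : ι → ℝ) : Matrix ι ι ℂ :=
  A + Matrix.diagonal fun i => ((c i * x i : ℝ) : ℂ)

theorem diagonalPerturbation_isHermitian {A : Matrix ι ι ℂ} (hA : A.IsHermitian) (c x : ι → ℝ) :
    (diagonalPerturbation A c x).IsHermitian :=
  hA.add_diagonal_ofReal _

theorem continuous_diagonalPerturbation (A : Matrix ι ι ℂ) (c : ι → ℝ) :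
    Continuous (diagonalPerturbation A c) := by
  unfold diagonalPerturbation
  fun_prop

theorem diagonalPerturbation_update (A : Matrix ι ι ℂ) (c x : ι → ℝ) (n : ι) (s t : ℝ) :
    diagonalPerturbation A c (Function.update x n t) =
      diagonalPerturbation A c (Function.update x n s) +
        Matrix.diagonal (Pi.single n ((c n * (t - s) : ℝ) : ℂ)) := by
  rw [diagonalPerturbation, diagonalPerturbation, add_assoc, Matrix.diagonal_add]
  congr 2
  funext i
  rcases eq_or_ne i n with rfl | h
  · simp only [Function.update_self, Pi.single_eq_same]
    push_cast
    ring
  · simp [h]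

end

variable {ι : Type*} [Fintype ι] [DecidableEq ι] {A : Matrix ι ι ℂ}

/-- The uniform distribution on the cube `[0, 1]^ι`. -/
noncomputable abbrev uniformCube (ι : Type*) [Fintype ι] : Measure (ι → ℝ) :=
  Measure.pi fun _ => volume.restrict (Set.Icc (0 : ℝ) 1)

instance isProbabilityMeasure_restrict_Icc_zero_one :
    IsProbabilityMeasure ((volume : Measure ℝ).restrict (Set.Icc 0 1)) :=
  ⟨by simp⟩

variable {c : ι → ℝ} {I : Set ℝ}

theorem lintegral_update_spectralProjection_le (hA : A.IsHermitian) (n : ι) (hc : 0 < c n)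
    (hI : I.OrdConnected) (hI_bdd : Bornology.IsBounded I) (x : ι → ℝ) :
    ∫⁻ t in Set.Icc (0 : ℝ) 1, ENNReal.ofReal (spectralProjection
      (diagonalPerturbation A c (Function.update x n t)) I n n).re
        ≤ ENNReal.ofReal ((c n)⁻¹ * volume.real I) := by
  have h := lintegral_spectralProjection_le
    (diagonalPerturbation_isHermitian hA c (Function.update x n 0)) hc n hI hI_bdd
  refine le_trans (le_of_eq (lintegral_congr fun t => ?_)) h
  rw [diagonalPerturbation_update A c x n 0 t, sub_zero]

theorem measurable_re_spectralProjection_diagonalPerturbation (hA : A.IsHermitian)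
    (hI : MeasurableSet I) (n : ι) : Measurable fun x : ι → ℝ =>
      (spectralProjection (diagonalPerturbation A c x) I n n).re :=
  measurable_re_spectralProjection (continuous_diagonalPerturbation A c)
    (diagonalPerturbation_isHermitian hA c) hI n

theorem measurable_re_trace_spectralProjection_diagonalPerturbation (hA : A.IsHermitian)
    (hI : MeasurableSet I) : Measurable fun x : ι → ℝ =>
      (spectralProjection (diagonalPerturbation A c x) I).trace.re := by
  simp only [re_trace_eq_sum]
  exact Finset.measurable_sum _ fun n _ =>
    measurable_re_spectralProjection_diagonalPerturbation hA hI n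

/-- The Wegner estimate for a random diagonal. -/
theorem lintegral_trace_spectralProjection_le (hA : A.IsHermitian) (hc : ∀ n, 0 < c n)
    (hI : I.OrdConnected) (hI_bdd : Bornology.IsBounded I) :
    ∫⁻ x, ENNReal.ofReal (spectralProjection (diagonalPerturbation A c x) I).trace.re
        ∂(uniformCube ι) ≤ ENNReal.ofReal (∑ n, (c n)⁻¹ * volume.real I) := by
  have hmeas := fun n => measurable_re_spectralProjection_diagonalPerturbation (c := c) hA
    hI.measurableSet n
  simp_rw [re_trace_eq_sum, ENNReal.ofReal_sum_of_nonneg (fun n _ => re_spectralProjection_nonneg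
    (diagonalPerturbation_isHermitian hA c _) I n)]
  rw [lintegral_finsetSum _ fun n _ => (hmeas n).ennreal_ofReal, ENNReal.ofReal_sum_of_nonneg
    fun n _ => mul_nonneg (inv_nonneg.2 (hc n).le) measureReal_nonneg]
  refine Finset.sum_le_sum fun n _ => ?_
  refine (lintegral_le_of_lmarginal_le {n} (hmeas n).ennreal_ofReal
    (measurable_const (a := ENNReal.ofReal ((c n)⁻¹ * volume.real I))) fun x => ?_).trans (by simp)
  rw [lmarginal_singleton, lmarginal_singleton]
  simpa using lintegral_update_spectralProjection_le hA n (hc n) hI hI_bdd x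

/-- The Minami estimate for a random diagonal. -/
theorem lintegral_trace_spectralProjection_mul_sub_one_le (hA : A.IsHermitian)
    (hc : ∀ n, 0 < c n) (hI : I.OrdConnected) (hI_bdd : Bornology.IsBounded I) :
    ∫⁻ x, ENNReal.ofReal ((spectralProjection (diagonalPerturbation A c x) I).trace.re *
        ((spectralProjection (diagonalPerturbation A c x) I).trace.re - 1)) ∂(uniformCube ι)
      ≤ ENNReal.ofReal ((∑ n, (c n)⁻¹ * volume.real I) ^ 2) := by
  let D : ι → (ι → ℝ) → ℝ := fun n x => (spectralProjection (diagonalPerturbation A c x) I n n).re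
  let T : (ι → ℝ) → ℝ := fun x => (spectralProjection (diagonalPerturbation A c x) I).trace.re
  let L : ι → ℝ := fun n => (c n)⁻¹ * volume.real I
  have hD : ∀ n, Measurable (D n) := fun n =>
    measurable_re_spectralProjection_diagonalPerturbation hA hI.measurableSet n
  have hT : Measurable T :=
    measurable_re_trace_spectralProjection_diagonalPerturbation hA hI.measurableSet
  have hDnn : ∀ n x, 0 ≤ D n x := fun n x =>
    re_spectralProjection_nonneg (diagonalPerturbation_isHermitian hA c _) I n
  have hL : ∀ n, 0 ≤ L n := fun n => mul_nonneg (inv_nonneg.2 (hc n).le) measureReal_nonneg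
  have hTD : ∀ x, T x = ∑ n, D n x := fun x => re_trace_eq_sum _
  -- If `T x < 1`, both sides vanish because `0 ≤ T x`, so the truncation in `ofReal` is harmless.
  have hexpand : ∀ x, ENNReal.ofReal (T x * (T x - 1))
      = ∑ n, ENNReal.ofReal (D n x) * ENNReal.ofReal (T x - 1) := by
    intro x
    rw [← Finset.sum_mul, ← ENNReal.ofReal_sum_of_nonneg fun n _ => hDnn n x, ← hTD,
      ENNReal.ofReal_mul (by rw [hTD]; exact Finset.sum_nonneg fun n _ => hDnn n x)]
  -- Resampling the variable at `n` changes the number of eigenvalues by at most one.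
  have hresample : ∀ n x s t, T (Function.update x n t) - 1 ≤ T (Function.update x n s) :=
    fun n x s t => sub_le_iff_le_add.2 (re_trace_spectralProjection_le_add_one
      (diagonalPerturbation_isHermitian hA c _) (diagonalPerturbation_isHermitian hA c _)
      (diagonalPerturbation_update A c x n s t) hI)
  have hterm : ∀ n, ∫⁻ x, ENNReal.ofReal (D n x) * ENNReal.ofReal (T x - 1) ∂(uniformCube ι)
      ≤ ENNReal.ofReal (L n) * ENNReal.ofReal (∑ m, L m) := by
    intro n
    calc ∫⁻ x, ENNReal.ofReal (D n x) * ENNReal.ofReal (T x - 1) ∂(uniformCube ι)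
        ≤ ∫⁻ x, ENNReal.ofReal (L n) * ENNReal.ofReal (T x) ∂(uniformCube ι) := by
          refine lintegral_le_of_lmarginal_le {n}
            ((hD n).ennreal_ofReal.mul (hT.sub_const 1).ennreal_ofReal)
            (hT.ennreal_ofReal.const_mul _) fun x => ?_
          rw [lmarginal_singleton, lmarginal_singleton]
          -- For fixed `s`, average over `t` in the factor `D n` alone; integrating over `s` afterwards
          -- turns the right-hand side into the marginal of `T`.
          have hs : ∀ s, ∫⁻ t in Set.Icc (0 : ℝ) 1, ENNReal.ofReal (D n (Function.update x n t)) *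
              ENNReal.ofReal (T (Function.update x n t) - 1)
              ≤ ENNReal.ofReal (L n) * ENNReal.ofReal (T (Function.update x n s)) := by
            intro s
            calc _ ≤ ∫⁻ t in Set.Icc (0 : ℝ) 1, ENNReal.ofReal (D n (Function.update x n t)) *
                    ENNReal.ofReal (T (Function.update x n s)) :=
                  lintegral_mono fun t => mul_le_mul_right
                    (ENNReal.ofReal_le_ofReal (hresample n x s t)) _
              _ = (∫⁻ t in Set.Icc (0 : ℝ) 1, ENNReal.ofReal (D n (Function.update x n t))) *
                    ENNReal.ofReal (T (Function.update x n s)) :=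
                  lintegral_mul_const' _ _ ENNReal.ofReal_ne_top
              _ ≤ _ := mul_le_mul_left
                  (lintegral_update_spectralProjection_le hA n (hc n) hI hI_bdd x) _
          have h := lintegral_mono (μ := volume.restrict (Set.Icc (0 : ℝ) 1)) hs
          simpa using h
      _ = ENNReal.ofReal (L n) * ∫⁻ x, ENNReal.ofReal (T x) ∂(uniformCube ι) :=
          lintegral_const_mul _ hT.ennreal_ofReal
      _ ≤ _ := mul_le_mul_right (lintegral_trace_spectralProjection_le hA hc hI hI_bdd) _
  calc _ = ∑ n, ∫⁻ x, ENNReal.ofReal (D n x) * ENNReal.ofReal (T x - 1) ∂(uniformCube ι) := by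
        rw [lintegral_congr hexpand]
        exact lintegral_finsetSum _ fun n _ =>
          (hD n).ennreal_ofReal.mul (hT.sub_const 1).ennreal_ofReal
    _ ≤ ∑ n, ENNReal.ofReal (L n) * ENNReal.ofReal (∑ m, L m) := Finset.sum_le_sum fun n _ => hterm n
    _ = _ := by
        rw [← Finset.sum_mul, ← ENNReal.ofReal_sum_of_nonneg fun n _ => hL n, sq,
          ENNReal.ofReal_mul (Finset.sum_nonneg fun n _ => hL n)]

end RandomDiagonal

/-! ### The random Schrödinger operator -/

section Hamiltonian

variable {d : ℕ}

theorem growthCoeff_pos (α : ℝ) (n : Fin d → ℤ) : 0 < growthCoeff α n := by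
  have h : 0 ≤ latticeNorm n ^ α := Real.rpow_nonneg (Real.sqrt_nonneg _) α
  unfold growthCoeff
  linarith

theorem hamiltonianMatrix_eq_diagonalPerturbation (α : ℝ) (q : (Fin d → ℤ) → ℝ)
    (Λ : Finset (Fin d → ℤ)) : hamiltonianMatrix α q Λ =
      diagonalPerturbation (hamiltonianMatrix α 0 Λ) (fun n : Λ => growthCoeff α (n : Fin d → ℤ))
        (fun n : Λ => q n) := by
  ext n m
  rcases eq_or_ne n m with rfl | h
  · simp [hamiltonianMatrix, diagonalPerturbation, hamiltonian]
  · have h' : (n : Fin d → ℤ) ≠ m := fun e => h (Subtype.ext e)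
    simp [hamiltonianMatrix, diagonalPerturbation, hamiltonian, h, h']

theorem map_restrict_eq_uniformCube {Ω : Type*} [MeasurableSpace Ω] (P : Measure Ω)
    [IsProbabilityMeasure P] {κ : Type*} {q : κ → Ω → ℝ} (hq_meas : ∀ n, Measurable (q n))
    (hq_indep : iIndepFun q P)
    (hq_unif : ∀ n, pdf.IsUniform (q n) (Set.Icc (0 : ℝ) 1) P volume) (Λ : Finset κ) :
    P.map (fun ω (n : Λ) => q n ω) = uniformCube Λ := by
  have h := (iIndepFun_iff_map_fun_eq_pi_map fun n : Λ => (hq_meas n).aemeasurable).1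
    (hq_indep.precomp Subtype.val_injective)
  rw [h]
  congr 1
  funext n
  rw [hq_unif n, ProbabilityTheory.cond]
  simp

theorem integrable_and_integral_le_of_lintegral_map_le {Ω X : Type*} [MeasurableSpace Ω]
    [MeasurableSpace X] {P : Measure Ω} [IsFiniteMeasure P] {Y : Ω → X} (hY : Measurable Y)
    {f : X → ℝ} (hf : Measurable f) (hf0 : ∀ x, 0 ≤ f x) {b : ℝ} (hb : 0 ≤ b)
    (hle : ∫⁻ x, ENNReal.ofReal (f x) ∂(P.map Y) ≤ ENNReal.ofReal b) :
    Integrable (fun ω => f (Y ω)) P ∧ ∫ ω, f (Y ω) ∂P ≤ b := by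
  rw [lintegral_map hf.ennreal_ofReal hY] at hle
  have hm : AEStronglyMeasurable (fun ω => f (Y ω)) P := (hf.comp hY).aestronglyMeasurable
  have h0 : 0 ≤ᵐ[P] fun ω => f (Y ω) := Filter.Eventually.of_forall fun ω => hf0 _
  refine ⟨(lintegral_ofReal_ne_top_iff_integrable hm h0).1
    (hle.trans_lt ENNReal.ofReal_lt_top).ne, ?_⟩
  rw [integral_eq_lintegral_of_nonneg_ae h0 hm]
  exact ENNReal.toReal_le_of_le_ofReal hb hle

theorem proposition2p3 {d : ℕ} {α : ℝ} (hα : 0 < α)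
    {Ω : Type*} [MeasurableSpace Ω] (P : Measure Ω) [IsProbabilityMeasure P]
    (q : (Fin d → ℤ) → Ω → ℝ) (hq_meas : ∀ n, Measurable (q n))
    (hq_indep : iIndepFun q P)
    (hq_unif : ∀ n, pdf.IsUniform (q n) (Set.Icc (0 : ℝ) 1) P volume)
    (Λ : Finset (Fin d → ℤ)) (I : Set ℝ) (hI : I.OrdConnected) (hI_bdd : Bornology.IsBounded I) :
    (Integrable (fun ω => traceSpectralProjection α (fun n => q n ω) Λ I) P ∧
      ∫ ω, traceSpectralProjection α (fun n => q n ω) Λ I ∂P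
        ≤ ∑ n ∈ Λ, (growthCoeff α n)⁻¹ * volume.real I) ∧
    (Integrable (fun ω => traceSpectralProjection α (fun n => q n ω) Λ I *
        (traceSpectralProjection α (fun n => q n ω) Λ I - 1)) P ∧
      ∫ ω, traceSpectralProjection α (fun n => q n ω) Λ I *
          (traceSpectralProjection α (fun n => q n ω) Λ I - 1) ∂P
        ≤ (∑ n ∈ Λ, (growthCoeff α n)⁻¹ * volume.real I) ^ 2) := by
  have hA := hamiltonianMatrix_isHermitian α 0 Λ
  have hc : ∀ n : Λ, 0 < growthCoeff α (n : Fin d → ℤ) := fun n => growthCoeff_pos α _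
  have hY : Measurable fun ω (n : Λ) => q n ω := measurable_pi_lambda _ fun n => hq_meas n
  have hmap := map_restrict_eq_uniformCube P hq_meas hq_indep hq_unif Λ
  have hT := measurable_re_trace_spectralProjection_diagonalPerturbation
    (c := fun n : Λ => growthCoeff α (n : Fin d → ℤ)) hA hI.measurableSet
  have hH := diagonalPerturbation_isHermitian hA fun n : Λ => growthCoeff α (n : Fin d → ℤ)
  have hsum : 0 ≤ ∑ n ∈ Λ, (growthCoeff α n)⁻¹ * volume.real I :=
    Finset.sum_nonneg fun n _ => mul_nonneg (inv_nonneg.2 (growthCoeff_pos α n).le)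
      measureReal_nonneg
  have hattach : ∑ n : Λ, (growthCoeff α (n : Fin d → ℤ))⁻¹ * volume.real I
      = ∑ n ∈ Λ, (growthCoeff α n)⁻¹ * volume.real I :=
    Finset.sum_coe_sort Λ fun n => (growthCoeff α n)⁻¹ * volume.real I
  simp only [traceSpectralProjection, hamiltonianMatrix_eq_diagonalPerturbation α (fun n => q n _)]
  constructor
  · refine integrable_and_integral_le_of_lintegral_map_le hY hT
      (fun x => re_trace_spectralProjection_nonneg (hH x) I) hsum ?_
    rw [hmap, ← hattach]
    exact lintegral_trace_spectralProjection_le hA hc hI hI_bdd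
  · refine integrable_and_integral_le_of_lintegral_map_le hY (hT.mul (hT.sub_const 1))
      (fun x => re_trace_spectralProjection_mul_sub_one_nonneg (hH x) I) (sq_nonneg _) ?_
    rw [hmap, ← hattach]
    exact lintegral_trace_spectralProjection_mul_sub_one_le hA hc hI hI_bdd

end Hamiltonian
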